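/- Let $H$ and $K$ be arbitrary (not necessarily separable) complex Hilbert spaces, let $B(H;K)$ be the space of bounded linear operators $H\to K$, and let $(\Sigma,\mathscr{H},\rho)$ be an arbitrary measure space. For $A\in B(H;K)$ and $p\in[1,\infty)$ let $$\|A\|_{\mathcal S_p}:=\Big(\sum_{e\in\mathcal E}\langle |A|^p e,e\rangle_H\Big)^{1/p}\in[0,\infty],\qquad |A|^p:=(A^*A)^{p/2},$$ where $\mathcal E$ is any orthonormal basis of $H$; let $\|A\|_{\mathcal S_\infty}$ be the operator norm of $A$; and let $\mathcal S_p(H;K):=\{A\in B(H;K):\|A\|_{\mathcal S_p}<\infty\}$ for $p\in[1,\infty]$. For an arbitrary, not necessarily measurable, function $h:\Sigma\to[0,\infty]$ let $$\underline{\int_\Sigma} h\,d\rho:=\sup\Big\{\int_\Sigma\tilde h\,d\rho:\ \tilde h:\Sigma\to[0,\infty]\text{ measurable},\ \tilde h\le h\ \rho\text{-a.e.}\Big\}$$ be its lower integral. Let $F:\Sigma\to B(H;K)$ be pointwise Pettis integrable, that is, for all $h\in H$ and $k\in K$ the function $\sigma\mapsto\langle F(\sigma)h,k\rangle_K$ is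 measurable and $\int_\Sigma|\langle F(\sigma)h,k\rangle_K|\,\rho(d\sigma)<\infty$. Let $\int_\Sigma F\,d\rho\in B(H;K)$ be its pointwise Pettis integral, the unique bounded operator with $$\Big\langle\Big(\int_\Sigma F\,d\rho\Big)h,k\Big\rangle_K=\int_\Sigma\langle F(\sigma)h,k\rangle_K\,\rho(d\sigma)\qquad(h\in H,\ k\in K).$$ Then, for every $p\in[1,\infty]$, $$\Big\|\int_\Sigma F\,d\rho\Big\|_{\mathcal S_p}\le\underline{\int_\Sigma}\|F(\sigma)\|_{\mathcal S_p}\,\rho(d\sigma).$$ In particular, if the right-hand side is finite, then $\int_\Sigma F\,d\rho\in\mathcal S_p(H;K)$. -/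

import Mathlib

open MeasureTheory Filter Topology
open scoped ENNReal

noncomputable section

namespace SchattenMinkowski

/-! ### Lower integrals -/

/-- The lower integral of an arbitrary (not necessarily measurable) function `h : Ω → [0, ∞]`:
the supremum of the integrals of the measurable functions that are `≤ h` almost everywhere. -/
def lowerIntegral {Ω : Type*} [MeasurableSpace Ω] (ρ : Measure Ω) (h : Ω → ℝ≥0∞) : ℝ≥0∞ :=
  ⨆ (g : Ω → ℝ≥0∞) (_ : Measurable g) (_ : ∀ᵐ σ ∂ρ, g σ ≤ h σ), ∫⁻ σ, g σ ∂ρ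

/-! ### Pointwise Pettis integrals -/

section Pettis

variable {Ω : Type*} [MeasurableSpace Ω]
variable {H : Type*} [NormedAddCommGroup H] [InnerProductSpace ℂ H]
variable {K : Type*} [NormedAddCommGroup K] [InnerProductSpace ℂ K]

/-- Pointwise weak measurability: every matrix coefficient `σ ↦ ⟨F(σ)h, k⟩` is measurable.
(Mathlib's inner product is linear in the second slot, hence the order of the arguments.) -/
def PointwiseWeaklyMeasurable (F : Ω → H →L[ℂ] K) : Prop :=
  ∀ (h : H) (k : K), Measurable fun σ => inner ℂ k (F σ h)

/-- Pointwise Pettis integrability: pointwise weak measurability together with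
`∫ |⟨F(σ)h, k⟩| ρ(dσ) < ∞` for all `h` and `k`. -/
structure PointwisePettisIntegrable (ρ : Measure Ω) (F : Ω → H →L[ℂ] K) : Prop where
  measurable : PointwiseWeaklyMeasurable F
  lintegral_lt_top : ∀ (h : H) (k : K), ∫⁻ σ, ‖inner ℂ k (F σ h)‖ₑ ∂ρ < ∞

/-- `A` is a pointwise Pettis integral of `F` (over the whole space): for every `h`, the vector
`A h` is the weak integral of `σ ↦ F(σ)h`, i.e. `⟨A h, k⟩ = ∫ ⟨F(σ)h, k⟩ ρ(dσ)` for all `k`. -/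
def IsPettisIntegral (ρ : Measure Ω) (F : Ω → H →L[ℂ] K) (A : H →L[ℂ] K) : Prop :=
  ∀ (h : H) (k : K), inner ℂ k (A h) = ∫ σ, inner ℂ k (F σ h) ∂ρ

theorem PointwisePettisIntegrable.integrable {ρ : Measure Ω} {F : Ω → H →L[ℂ] K}
    (hF : PointwisePettisIntegrable ρ F) (h : H) (k : K) :
    Integrable (fun σ => inner ℂ k (F σ h)) ρ :=
  ⟨(hF.measurable h k).aestronglyMeasurable, hF.lintegral_lt_top h k⟩

theorem IsPettisIntegral.unique {ρ : Measure Ω} {F : Ω → H →L[ℂ] K} {A B : H →L[ℂ] K}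
    (hA : IsPettisIntegral ρ F A) (hB : IsPettisIntegral ρ F B) : A = B := by
  ext h
  exact ext_inner_left ℂ fun k => (hA h k).trans (hB h k).symm

/-- Scalar integration of an everywhere integrable family of functionals is continuous. -/
theorem exists_integral_functional {E : Type*} [NormedAddCommGroup E] [NormedSpace ℂ E]
    [CompleteSpace E] (ρ : Measure Ω) (G : Ω → E →L[ℂ] ℂ)
    (hG : ∀ x, Integrable (fun σ => G σ x) ρ) :
    ∃ ψ : E →L[ℂ] ℂ, ∀ x, ψ x = ∫ σ, G σ x ∂ρ := by
  let g : E →ₗ[ℂ] (Ω →₁[ρ] ℂ) :=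
    { toFun := fun x => (hG x).toL1 _
      map_add' := fun x y => by
        rw [← Integrable.toL1_add]
        congr 1
        ext σ
        simp
      map_smul' := fun c x => by
        rw [RingHom.id_apply, ← Integrable.toL1_smul]
        congr 1
        ext σ
        simp }
  have hg : Continuous g := by
    refine LinearMap.continuous_of_seq_closed_graph g fun u x y hu hy => ?_
    obtain ⟨ns, hns, hae⟩ := (tendstoInMeasure_of_tendsto_Lp hy).exists_seq_tendsto_ae
    have h1 : ∀ᵐ σ ∂ρ, ∀ n, g (u n) σ = G σ (u n) :=
      ae_all_iff.2 fun n => (hG (u n)).coeFn_toL1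
    refine Lp.ext ?_
    filter_upwards [hae, h1, (hG x).coeFn_toL1] with σ h2 h3 h4
    refine (tendsto_nhds_unique h2 ?_).trans h4.symm
    have h5 : Tendsto (fun i => G σ (u (ns i))) atTop (𝓝 (G σ x)) :=
      ((G σ).continuous.tendsto x).comp (hu.comp hns.tendsto_atTop)
    exact h5.congr fun i => (h3 (ns i)).symm
  let ψ : E →ₗ[ℂ] ℂ :=
    { toFun := fun x => ∫ σ, G σ x ∂ρ
      map_add' := fun x y => by
        rw [← integral_add (hG x) (hG y)]
        simp
      map_smul' := fun c x => by
        rw [RingHom.id_apply, ← integral_smul]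
        simp }
  have hψ : Continuous ψ := by
    have h6 : (ψ : E → ℂ) = fun x => ∫ σ, g x σ ∂ρ := by
      ext x
      exact integral_congr_ae (hG x).coeFn_toL1.symm
    rw [h6]
    exact continuous_integral.comp hg
  exact ⟨⟨ψ, hψ⟩, fun x => rfl⟩

theorem exists_isPettisIntegral [CompleteSpace H] [CompleteSpace K] {ρ : Measure Ω}
    {F : Ω → H →L[ℂ] K} (hF : PointwisePettisIntegrable ρ F) :
    ∃ A, IsPettisIntegral ρ F A := by
  have h1 : ∀ h : H, ∃ v : K, ∀ k, inner ℂ k v = ∫ σ, inner ℂ k (F σ h) ∂ρ := by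
    intro h
    obtain ⟨ψ, hψ⟩ := exists_integral_functional ρ (fun σ => innerSL ℂ (F σ h)) (fun k => by
      have h0 := (LinearIsometryEquiv.integrable_comp_iff (Complex.conjLIE)).2 (hF.integrable h k)
      refine h0.congr (Eventually.of_forall fun σ => ?_)
      simp)
    refine ⟨(InnerProductSpace.toDual ℂ K).symm ψ, fun k => ?_⟩
    rw [← inner_conj_symm, InnerProductSpace.toDual_symm_apply, hψ, ← integral_conj]
    refine integral_congr_ae (Eventually.of_forall fun σ => ?_)
    simp
  have h2 : ∀ k : K, ∃ ψ : H →L[ℂ] ℂ, ∀ h, ψ h = ∫ σ, inner ℂ k (F σ h) ∂ρ := fun k =>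
    exists_integral_functional ρ (fun σ => (innerSL ℂ k).comp (F σ)) (hF.integrable · k)
  choose v hv using h1
  choose ψ hψ using h2
  let V : H →ₗ[ℂ] K :=
    { toFun := v
      map_add' := fun x y => ext_inner_left ℂ fun k => by
        rw [inner_add_right, hv, hv, hv, ← hψ, ← hψ, ← hψ, map_add]
      map_smul' := fun c x => ext_inner_left ℂ fun k => by
        rw [RingHom.id_apply, inner_smul_right, hv, hv, ← hψ, ← hψ, map_smul, smul_eq_mul] }
  have hV : Continuous V := by
    refine LinearMap.continuous_of_seq_closed_graph V fun u x y hu hy => ?_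
    refine ext_inner_left ℂ fun k => ?_
    have h3 : Tendsto (fun n => inner ℂ k (V (u n))) atTop (𝓝 (inner ℂ k y)) :=
      tendsto_const_nhds.inner hy
    have h4 : Tendsto (fun n => ψ k (u n)) atTop (𝓝 (ψ k x)) :=
      ((ψ k).continuous.tendsto x).comp hu
    refine (tendsto_nhds_unique h3 (h4.congr fun n => ?_)).trans ?_
    · exact (hψ k _).trans (hv _ k).symm
    · exact (hψ k _).trans (hv _ k).symm
  exact ⟨⟨V, hV⟩, hv⟩

/-- The pointwise Pettis integral of a pointwise Pettis integrable map. -/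
def pettisIntegral [CompleteSpace H] [CompleteSpace K] {ρ : Measure Ω} {F : Ω → H →L[ℂ] K}
    (hF : PointwisePettisIntegrable ρ F) : H →L[ℂ] K :=
  (exists_isPettisIntegral hF).choose

theorem isPettisIntegral_pettisIntegral [CompleteSpace H] [CompleteSpace K] {ρ : Measure Ω}
    {F : Ω → H →L[ℂ] K} (hF : PointwisePettisIntegrable ρ F) :
    IsPettisIntegral ρ F (pettisIntegral hF) :=
  (exists_isPettisIntegral hF).choose_spec

end Pettis

/-! ### Schatten classes -/

section Schatten

variable {H : Type*} [NormedAddCommGroup H] [InnerProductSpace ℂ H] [CompleteSpace H]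
variable {K : Type*} [NormedAddCommGroup K] [InnerProductSpace ℂ K] [CompleteSpace K]

/-- `|A|^p = (A*A)^(p/2)`, through the continuous functional calculus on `B(H)`. -/
def absPow (A : H →L[ℂ] K) (p : ℝ) : H →L[ℂ] H :=
  ((ContinuousLinearMap.adjoint A).comp A) ^ (p / 2)

/-- The Schatten `p`-norm, with values in `[0, ∞]`: for `p < ∞` it is
`(∑ₑ ⟨|A|^p e, e⟩)^(1/p)`, the sum being over the orthonormal basis `b` of `H` (its terms are
nonnegative reals), and for `p = ∞` it is the operator norm. -/
def schattenNorm {ι : Type*} (b : HilbertBasis ι ℂ H) (p : ℝ≥0∞) (A : H →L[ℂ] K) : ℝ≥0∞ :=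
  if p = ∞ then ‖A‖ₑ
  else (∑' i, ENNReal.ofReal (inner ℂ (b i) (absPow A p.toReal (b i))).re) ^ (1 / p.toReal)

/-- The Schatten class `S_p(H;K)`: the operators with finite Schatten `p`-norm
(all of `B(H;K)` for `p = ∞`). -/
def schattenClass {ι : Type*} (b : HilbertBasis ι ℂ H) (K : Type*) [NormedAddCommGroup K]
    [InnerProductSpace ℂ K] [CompleteSpace K] (p : ℝ≥0∞) : Set (H →L[ℂ] K) :=
  {A | schattenNorm b p A < ∞}

end Schatten

end SchattenMinkowski

end

open MeasureTheory Filter Topology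
open scoped ENNReal
open ContinuousLinearMap

/-! For `1 ≤ p < ∞` the Schatten norm of `A` is the supremum of the `ℓ^p` norms of the diagonals `⟨W
A e_k, e_k⟩`, over contractions `W` and finite orthonormal systems `e`. Each diagonal involves only
finitely many matrix coefficients. For `A = ∫ F` it is therefore the integral of a measurable
`ℂⁿ`-valued function, and the triangle inequality for integrals in `ℓ^p_n` applies. The `ℓ^p` norm
of the diagonal of `W F(σ)` is a measurable minorant of `‖F(σ)‖_{S_p}`, so the lower integral is the
natural bound, and neither separability nor measurability of the norm is needed.

That diagonals are dominated (`sum_norm_inner_rpow_le`) follows from polar decomposition,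
Cauchy–Schwarz for the form `⟨|A|x, y⟩`, and Jensen's inequality. That they exhaust the norm
(`exists_orthonormal_sum_rpow_ge`) is seen with `W = V*`, where `A = V|A|` and `V*A = |A|`:
eigenvectors of a finite-dimensional compression of `|A|` replace a spectral decomposition, which a
general `|A|` lacks.

For `p = ∞` single coefficients between unit vectors suffice. -/

namespace SchattenMinkowski

/-! ### Absolute value, polar decomposition and the upper bound for diagonals. -/

section AbsoluteValue

/-- Parseval's identity for a Hilbert basis, in `[0, ∞]`. -/
theorem tsum_ofReal_norm_inner_sq {ι H : Type*} [NormedAddCommGroup H]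
    [InnerProductSpace ℂ H] (b : HilbertBasis ι ℂ H) (x : H) :
    ∑' i, ENNReal.ofReal (‖(inner ℂ (b i) x : ℂ)‖ ^ 2) = ENNReal.ofReal (‖x‖ ^ 2) := by
  have h1 : HasSum (fun i => ‖(inner ℂ (b i) x : ℂ)‖ ^ 2) (‖x‖ ^ 2) := by
    have h2 := Complex.hasSum_re (b.hasSum_inner_mul_inner x x)
    rw [show (inner ℂ x x).re = ‖x‖ ^ 2 from inner_self_eq_norm_sq (𝕜 := ℂ) x] at h2
    refine h2.congr_fun fun i => ?_
    rw [norm_inner_symm, ← inner_conj_symm (b i) x, Complex.mul_conj, Complex.normSq_eq_norm_sq,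
      Complex.ofReal_re]
  rw [← h1.tsum_eq, ENNReal.ofReal_tsum_of_nonneg (fun i => sq_nonneg _) h1.summable]

variable {H : Type*} [NormedAddCommGroup H] [InnerProductSpace ℂ H] [CompleteSpace H]
variable {K : Type*} [NormedAddCommGroup K] [InnerProductSpace ℂ K] [CompleteSpace K]

/-- The operator `A*A` is nonnegative. -/
theorem adjoint_comp_self_nonneg (A : H →L[ℂ] K) : 0 ≤ (adjoint A).comp A :=
  (ContinuousLinearMap.nonneg_iff_isPositive _).2 (isPositive_adjoint_comp_self A)

/-- The absolute value `(A*A)^(1/2)` of an operator between Hilbert spaces. -/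
noncomputable def absOp (A : H →L[ℂ] K) : H →L[ℂ] H := CFC.sqrt ((adjoint A).comp A)

theorem absOp_nonneg (A : H →L[ℂ] K) : 0 ≤ absOp A := CFC.sqrt_nonneg _

theorem absPow_eq_absOp_rpow (A : H →L[ℂ] K) {p : ℝ} (hp : 0 ≤ p) :
    absPow A p = absOp A ^ p := by
  have hA := adjoint_comp_self_nonneg A
  rw [absPow, absOp, CFC.sqrt_eq_rpow,
    CFC.rpow_rpow_of_exponent_nonneg _ _ _ (by norm_num) hp]
  congr 1
  ring

theorem inner_apply_self_of_nonneg_eq {S : H →L[ℂ] H} (hS : 0 ≤ S) (x y : H) :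
    inner ℂ x (S y) = inner ℂ (CFC.sqrt S x) (CFC.sqrt S y) := by
  have h1 : IsSelfAdjoint (CFC.sqrt S) := .of_nonneg (CFC.sqrt_nonneg S)
  conv_lhs => rw [← CFC.sqrt_mul_sqrt_self S hS]
  rw [mul_apply_eq_comp, ← adjoint_inner_left,
    isSelfAdjoint_iff'.1 h1]

theorem re_inner_apply_self_of_nonneg {S : H →L[ℂ] H} (hS : 0 ≤ S) (x : H) :
    (inner ℂ x (S x)).re = ‖CFC.sqrt S x‖ ^ 2 := by
  rw [inner_apply_self_of_nonneg_eq hS]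
  exact inner_self_eq_norm_sq (𝕜 := ℂ) _

theorem re_inner_apply_mono {S T : H →L[ℂ] H} (h : S ≤ T) (x : H) :
    (inner ℂ x (S x)).re ≤ (inner ℂ x (T x)).re := by
  have h1 := re_inner_apply_self_of_nonneg (sub_nonneg.2 h) x
  rw [sub_apply, inner_sub_right, Complex.sub_re] at h1
  nlinarith [sq_nonneg ‖CFC.sqrt (T - S) x‖]

/-- Both squares equal `⟨A*A x, x⟩`. Hence `|A|x ↦ Ax` is well defined and isometric on the range of
`|A|`. -/
theorem norm_absOp_apply (A : H →L[ℂ] K) (x : H) : ‖absOp A x‖ = ‖A x‖ := by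
  have h := re_inner_apply_self_of_nonneg (adjoint_comp_self_nonneg A) x
  rw [ContinuousLinearMap.comp_apply, adjoint_inner_right] at h
  have h2 := inner_self_eq_norm_sq (𝕜 := ℂ) (A x)
  have h3 : ‖absOp A x‖ ^ 2 = ‖A x‖ ^ 2 := by
    rw [absOp, ← h, ← h2]; rfl
  exact (sq_eq_sq₀ (norm_nonneg _) (norm_nonneg _)).1 h3

/-- Polar decomposition, with a contraction as the left factor. -/
theorem exists_polar (A : H →L[ℂ] K) :
    ∃ V : H →L[ℂ] K, ‖V‖ ≤ 1 ∧ A = V.comp (absOp A) ∧ (adjoint V).comp A = absOp A := by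
  obtain ⟨V, hV, hA⟩ : ∃ V : H →L[ℂ] K, ‖V‖ ≤ 1 ∧ ∀ x, V (absOp A x) = A x := by
    let R : Submodule ℂ H := (LinearMap.range (absOp A).toLinearMap).topologicalClosure
    have hR : ∀ x, absOp A x ∈ R := fun x =>
      Submodule.le_topologicalClosure _ (LinearMap.mem_range_self _ x)
    have : CompleteSpace R :=
      (Submodule.isClosed_topologicalClosure _).completeSpace_coe
    let e : H →ₗ[ℂ] R := (absOp A).toLinearMap.codRestrict R hR
    have he : DenseRange e := by
      intro y
      rw [closure_subtype]
      have h2 : ((↑) '' Set.range e : Set H) = LinearMap.range (absOp A).toLinearMap := by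
        ext z
        constructor
        · rintro ⟨_, ⟨x, rfl⟩, rfl⟩
          exact ⟨x, rfl⟩
        · rintro ⟨x, rfl⟩
          exact ⟨_, ⟨x, rfl⟩, rfl⟩
      rw [h2]
      exact y.2
    have hn : ∀ x, ‖A.toLinearMap x‖ ≤ 1 * ‖e x‖ := fun x => by
      rw [one_mul]
      exact (norm_absOp_apply A x).ge
    -- `V` extends `|A|x ↦ Ax` continuously to the closed range of `|A|` and vanishes on its
    -- orthogonal complement.
    refine ⟨(A.toLinearMap.extendOfNorm e).comp R.orthogonalProjectionOnto, ?_, fun x => ?_⟩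
    · refine ContinuousLinearMap.opNorm_le_bound _ zero_le_one fun x => ?_
      refine (LinearMap.norm_extendOfNorm_apply_le he 1 hn _).trans ?_
      exact mul_le_mul_of_nonneg_left (R.norm_orthogonalProjectionOnto_apply_le x) zero_le_one
    · have h3 : R.orthogonalProjectionOnto (absOp A x) = e x :=
        Submodule.orthogonalProjectionOnto_mem_subspace_eq_self (⟨_, hR x⟩ : R)
      rw [ContinuousLinearMap.comp_apply, h3]
      exact LinearMap.extendOfNorm_eq he ⟨1, hn⟩ x
  refine ⟨V, hV, ?_, ?_⟩
  · ext x
    exact (hA x).symm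
  · ext x
    have h1 : ‖(adjoint V) (A x)‖ ≤ ‖A x‖ := by
      refine (le_opNorm _ _).trans ?_
      rw [LinearIsometryEquiv.norm_map]
      exact mul_le_of_le_one_left (norm_nonneg _) hV
    -- In the expanded square the cross term is `⟨Ax, V|A|x⟩ = ‖Ax‖²`, and neither outer term
    -- exceeds `‖Ax‖²`.
    have h2 : ‖(adjoint V) (A x) - absOp A x‖ ^ 2 ≤ 0 := by
      rw [@norm_sub_sq ℂ, adjoint_inner_left, hA, inner_self_eq_norm_sq, norm_absOp_apply]
      nlinarith [norm_nonneg ((adjoint V) (A x))]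
    have h3 : ‖(adjoint V) (A x) - absOp A x‖ = 0 := by
      nlinarith [norm_nonneg ((adjoint V) (A x) - absOp A x)]
    exact sub_eq_zero.1 (norm_eq_zero.1 h3)

/-- Compressing a nonnegative operator by a contraction does not increase its trace. -/
theorem sum_inner_adjoint_le_tsum {ι : Type*} (b : HilbertBasis ι ℂ H) {S : H →L[ℂ] H}
    (hS : 0 ≤ S) {C : H →L[ℂ] H} (hC : ‖C‖ ≤ 1) {n : ℕ} {e : Fin n → H}
    (he : Orthonormal ℂ e) :
    ∑ k, ENNReal.ofReal (inner ℂ (adjoint C (e k)) (S (adjoint C (e k)))).re ≤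
      ∑' i, ENNReal.ofReal (inner ℂ (b i) (S (b i))).re := by
  have h1 : IsSelfAdjoint (CFC.sqrt S) := .of_nonneg (CFC.sqrt_nonneg S)
  have h2 : ∀ (i : ι) (k : Fin n), ‖(inner ℂ (b i) (CFC.sqrt S (adjoint C (e k))) : ℂ)‖ =
      ‖(inner ℂ (e k) (C (CFC.sqrt S (b i))) : ℂ)‖ := fun i k => by
    rw [← norm_inner_symm, ← adjoint_inner_right, isSelfAdjoint_iff'.1 h1, adjoint_inner_left]
  simp_rw [re_inner_apply_self_of_nonneg hS]
  -- Parseval in `b`, an exchange of the two sums, then Bessel in `e`.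
  calc _ = ∑ k, ∑' i, ENNReal.ofReal (‖(inner ℂ (e k) (C (CFC.sqrt S (b i))) : ℂ)‖ ^ 2) := by
        refine Finset.sum_congr rfl fun k _ => ?_
        rw [← tsum_ofReal_norm_inner_sq b]
        simp_rw [h2]
    _ = ∑' i, ∑ k, ENNReal.ofReal (‖(inner ℂ (e k) (C (CFC.sqrt S (b i))) : ℂ)‖ ^ 2) :=
        (Summable.tsum_finsetSum fun _ _ => ENNReal.summable).symm
    _ ≤ _ := by
        refine ENNReal.tsum_le_tsum fun i => ?_
        rw [← ENNReal.ofReal_sum_of_nonneg fun _ _ => sq_nonneg _]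
        refine ENNReal.ofReal_le_ofReal ((he.sum_inner_products_le _).trans ?_)
        gcongr
        exact (C.le_of_opNorm_le hC _).trans_eq (one_mul _)

/-- The convex function `t ^ p` lies above its tangent at `c`; this is Bernoulli's inequality at `t
/ c - 1`, rescaled. -/
theorem rpow_ge_tangent {p c t : ℝ} (hp : 1 ≤ p) (hc : 0 < c) (ht : 0 ≤ t) :
    p * c ^ (p - 1) * t + (-(p - 1) * c ^ p) ≤ t ^ p := by
  have h1 := one_add_mul_self_le_rpow_one_add (s := t / c - 1)
    (by linarith [div_nonneg ht hc.le]) hp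
  rw [add_sub_cancel, Real.div_rpow ht hc.le, le_div_iff₀ (Real.rpow_pos_of_pos hc p)] at h1
  refine le_trans (le_of_eq ?_) h1
  rw [Real.rpow_sub_one hc.ne']
  field_simp
  ring

/-- Jensen's inequality for vector states of nonnegative operators. -/
theorem re_inner_rpow_le {T : H →L[ℂ] H} (hT : 0 ≤ T) {p : ℝ} (hp : 1 ≤ p) {u : H}
    (hu : ‖u‖ ≤ 1) : (inner ℂ u (T u)).re ^ p ≤ (inner ℂ u ((T ^ p) u)).re := by
  set c := (inner ℂ u (T u)).re with hc
  have hc0 : 0 ≤ c := by rw [hc, re_inner_apply_self_of_nonneg hT]; positivity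
  have hTp : 0 ≤ T ^ p := CFC.rpow_nonneg
  rcases hc0.eq_or_lt with h0 | h0
  · rw [← h0, Real.zero_rpow (by linarith), re_inner_apply_self_of_nonneg hTp]
    positivity
  have hsa : IsSelfAdjoint T := .of_nonneg hT
  -- The tangent is taken at the mean value `c = ⟨T u, u⟩`; functional calculus turns the scalar
  -- inequality on the spectrum into `q(T) ≤ T ^ p`.
  let q : Polynomial ℝ := Polynomial.C (p * c ^ (p - 1)) * Polynomial.X +
    Polynomial.C (-(p - 1) * c ^ p)
  have h1 : Polynomial.aeval T q ≤ T ^ p := by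
    rw [CFC.rpow_eq_cfc_real, ← cfc_polynomial q T]
    refine cfc_mono (fun t ht => ?_) (by fun_prop)
      (Real.continuous_rpow_const (by linarith)).continuousOn
    simp only [q, Polynomial.eval_add, Polynomial.eval_mul, Polynomial.eval_C, Polynomial.eval_X]
    exact rpow_ge_tangent hp h0 (spectrum_nonneg_of_nonneg hT ht)
  have hq : Polynomial.aeval T q = (p * c ^ (p - 1)) • T +
      (-(p - 1) * c ^ p) • (1 : H →L[ℂ] H) := by
    simp only [q, map_add, map_mul, Polynomial.aeval_C, Polynomial.aeval_X,
      Algebra.algebraMap_eq_smul_one, smul_mul_assoc, one_mul, smul_smul]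
  rw [hq] at h1
  refine le_trans ?_ (re_inner_apply_mono h1 u)
  have h2 : (inner ℂ u (((p * c ^ (p - 1)) • T +
      (-(p - 1) * c ^ p) • (1 : H →L[ℂ] H)) u)).re =
      p * c ^ (p - 1) * c + (-(p - 1) * c ^ p) * ‖u‖ ^ 2 := by
    rw [add_apply, inner_add_right,
      Complex.add_re, smul_apply, smul_apply,
      inner_smul_right_eq_smul, inner_smul_right_eq_smul, Complex.smul_re, Complex.smul_re, ← hc,
      one_apply_eq_self, smul_eq_mul, smul_eq_mul]
    congr 2
    exact inner_self_eq_norm_sq (𝕜 := ℂ) u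
  rw [h2, mul_assoc, ← Real.rpow_add_one h0.ne', sub_add_cancel]
  -- The constant term of the tangent is nonpositive, so `‖u‖ ≤ 1` is enough.
  have h3 : ‖u‖ ^ 2 ≤ 1 := pow_le_one₀ (norm_nonneg _) hu
  have h4 : 0 ≤ (p - 1) * c ^ p := mul_nonneg (by linarith) (by positivity)
  nlinarith

/-- The diagonal of `W A` in an orthonormal system, with a contraction `W`, is bounded in `ℓ^p` by
the Schatten norm of `A`. -/
theorem sum_norm_inner_rpow_le {ι : Type*} (b : HilbertBasis ι ℂ H) (A : H →L[ℂ] K)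
    {W : K →L[ℂ] H} (hW : ‖W‖ ≤ 1) {p : ℝ} (hp : 1 ≤ p) {n : ℕ} {e : Fin n → H}
    (he : Orthonormal ℂ e) :
    ∑ k, ENNReal.ofReal (‖(inner ℂ (e k) (W (A (e k))) : ℂ)‖ ^ p) ≤
      ∑' i, ENNReal.ofReal (inner ℂ (b i) (absPow A p (b i))).re := by
  obtain ⟨V, hV, hA, -⟩ := exists_polar A
  rw [absPow_eq_absOp_rpow A (by linarith)]
  have hT := absOp_nonneg A
  set T := absOp A
  have hTp : 0 ≤ T ^ p := CFC.rpow_nonneg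
  set C : H →L[ℂ] H := W.comp V
  have hC : ‖C‖ ≤ 1 := (opNorm_comp_le W V).trans (mul_le_one₀ hW (norm_nonneg _) hV)
  have h1 := sum_inner_adjoint_le_tsum b hTp hC he
  have h2 := sum_inner_adjoint_le_tsum b hTp (C := 1) norm_id_le he
  have hadj : adjoint (1 : H →L[ℂ] H) = 1 := by
    rw [← star_eq_adjoint, star_one]
  simp_rw [hadj, one_apply_eq_self] at h2
  have hpos : ∀ u, 0 ≤ (inner ℂ u ((T ^ p) u)).re := fun u => by
    rw [re_inner_apply_self_of_nonneg hTp]; positivity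
  have h3 : ∀ k, ENNReal.ofReal (‖(inner ℂ (e k) (W (A (e k))) : ℂ)‖ ^ p) ≤
      2⁻¹ * ENNReal.ofReal (inner ℂ (adjoint C (e k)) ((T ^ p) (adjoint C (e k)))).re +
      2⁻¹ * ENNReal.ofReal (inner ℂ (e k) ((T ^ p) (e k))).re := by
    intro k
    have hu : ‖adjoint C (e k)‖ ≤ 1 := by
      refine (le_opNorm _ _).trans ?_
      rw [LinearIsometryEquiv.norm_map, he.1 k, mul_one]
      exact hC
    have h4 := re_inner_rpow_le hT hp hu
    have h5 := re_inner_rpow_le hT hp (he.1 k).le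
    rw [re_inner_apply_self_of_nonneg hT] at h4 h5
    -- Cauchy–Schwarz for the form of `T`. After taking `p`-th powers, `2ab ≤ a² + b²` separates the
    -- factors and Jensen bounds each of them.
    have h6 : ‖(inner ℂ (e k) (W (A (e k))) : ℂ)‖ ≤
        ‖CFC.sqrt T (adjoint C (e k))‖ * ‖CFC.sqrt T (e k)‖ := by
      have h7 : W (A (e k)) = C (T (e k)) := by
        rw [hA]; rfl
      rw [h7, ← adjoint_inner_left, inner_apply_self_of_nonneg_eq hT]
      exact norm_inner_le_norm _ _
    have h8 := Real.rpow_le_rpow (norm_nonneg _) h6 (by linarith : 0 ≤ p)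
    rw [Real.mul_rpow (norm_nonneg _) (norm_nonneg _)] at h8
    have h9 : ∀ x : ℝ, 0 ≤ x → (x ^ 2) ^ p = (x ^ p) ^ 2 := fun x hx => by
      rw [← Real.rpow_natCast, ← Real.rpow_natCast, ← Real.rpow_mul hx, ← Real.rpow_mul hx,
        mul_comm]
    rw [h9 _ (norm_nonneg _)] at h4 h5
    have h10 : ‖(inner ℂ (e k) (W (A (e k))) : ℂ)‖ ^ p ≤
        2⁻¹ * (inner ℂ (adjoint C (e k)) ((T ^ p) (adjoint C (e k)))).re +
        2⁻¹ * (inner ℂ (e k) ((T ^ p) (e k))).re := by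
      nlinarith [sq_nonneg (‖CFC.sqrt T (adjoint C (e k))‖ ^ p - ‖CFC.sqrt T (e k)‖ ^ p)]
    refine (ENNReal.ofReal_le_ofReal h10).trans_eq ?_
    rw [ENNReal.ofReal_add (mul_nonneg (by norm_num) (hpos _))
      (mul_nonneg (by norm_num) (hpos _)), ENNReal.ofReal_mul (by norm_num),
      ENNReal.ofReal_mul (by norm_num), ENNReal.ofReal_inv_of_pos (by norm_num),
      ENNReal.ofReal_ofNat]
  refine (Finset.sum_le_sum fun k _ => h3 k).trans ?_
  rw [Finset.sum_add_distrib, ← Finset.mul_sum, ← Finset.mul_sum]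
  refine (add_le_add (mul_le_mul_right h1 _) (mul_le_mul_right h2 _)).trans_eq ?_
  rw [← add_mul, ENNReal.inv_two_add_inv_two, one_mul]

end AbsoluteValue

/-! ### Approximating the trace of `T ^ p` by diagonals of `T`. -/

section Compression

/-- On a Krylov subspace the compression of `T` has the same low powers as `T`. -/
theorem compression_pow_apply {H : Type*} [NormedAddCommGroup H] [InnerProductSpace ℂ H]
    (T : H →L[ℂ] H) (E : Submodule ℂ H) [E.HasOrthogonalProjection]
    {x : H} {n : ℕ} (hx : ∀ j ≤ n, (T ^ j) x ∈ E) {S : E →ₗ[ℂ] E}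
    (hS : ∀ y : E, S y = E.orthogonalProjectionOnto (T y)) (x' : E) (hx' : (x' : H) = x) :
    ∀ j ≤ n, (((S ^ j) x' : E) : H) = (T ^ j) x := by
  intro j
  induction j with
  | zero => intro _; simpa using hx'
  | succ j ih =>
    intro hj
    have h := hx (j + 1) hj
    rw [pow_succ', Module.End.mul_apply, hS, ih (by omega), ← mul_apply_eq_comp,
      ← pow_succ']
    exact congrArg Subtype.val (Submodule.orthogonalProjectionOnto_mem_subspace_eq_self (⟨_, h⟩ : E))

variable {H : Type*} [NormedAddCommGroup H] [InnerProductSpace ℂ H] [CompleteSpace H]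

/-- The trace of `T^p` over finitely many orthonormal vectors is approximated from above by `ℓ^p`
sums of diagonals of `T` in finite orthonormal systems. -/
theorem exists_orthonormal_sum_rpow_ge {T : H →L[ℂ] H} (hT : 0 ≤ T) {p : ℝ} (hp : 1 ≤ p)
    {m : ℕ} {b : Fin m → H} (hb : Orthonormal ℂ b) {ε : ℝ} (hε : 0 < ε) :
    ∃ (n : ℕ) (e : Fin n → H), Orthonormal ℂ e ∧
      ∑ i, (inner ℂ (b i) ((T ^ p) (b i))).re ≤
        (∑ k, ‖(inner ℂ (e k) (T (e k)) : ℂ)‖ ^ p) + 2 * m * ε := by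
  -- `M` bounds both the spectrum of `T` (first summand) and the eigenvalues of its compression
  -- (second summand). The factor `‖1‖` is kept because it is `0` when `H` is trivial.
  set M : ℝ := ‖T‖ * ‖(1 : H →L[ℂ] H)‖ + ‖T‖
  have hpow : Continuous fun t : ℝ => t ^ p := Real.continuous_rpow_const (by linarith)
  obtain ⟨q, hq⟩ := exists_polynomial_near_of_continuousOn 0 M (fun t : ℝ => t ^ p)
    hpow.continuousOn ε hε
  have hsa : IsSelfAdjoint T := .of_nonneg hT
  have hspec : ∀ t ∈ spectrum ℝ T, t ∈ Set.Icc 0 M := fun t ht => by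
    refine ⟨spectrum_nonneg_of_nonneg hT ht, ?_⟩
    have h1 := spectrum.norm_le_norm_mul_of_mem ht
    have h2 := le_abs_self t
    rw [Real.norm_eq_abs] at h1
    linarith [norm_nonneg T]
  -- the functional calculus is dominated by the polynomial
  have hTp : T ^ p ≤ Polynomial.aeval T (q + Polynomial.C ε) := by
    rw [CFC.rpow_eq_cfc_real, ← cfc_polynomial (q + Polynomial.C ε) T]
    refine cfc_mono (fun t ht => ?_) hpow.continuousOn (by fun_prop)
    have := (abs_lt.1 (hq t (hspec t ht))).1
    simp only [Polynomial.eval_add, Polynomial.eval_C]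
    linarith
  -- Krylov space of the `b i`, up to the degree of `q`: the compression `S` of `T` to `E` then
  -- satisfies `⟨q(S) b_i, b_i⟩ = ⟨q(T) b_i, b_i⟩`. The required system consists of the eigenvectors
  -- of `S`.
  let E : Submodule ℂ H := Submodule.span ℂ
    (Set.range fun x : Fin m × Fin (q.natDegree + 1) => (T ^ (x.2 : ℕ)) (b x.1))
  have : FiniteDimensional ℂ E := FiniteDimensional.span_of_finite ℂ (Set.finite_range _)
  have hE : ∀ i, ∀ j ≤ q.natDegree, (T ^ j) (b i) ∈ E := fun i j hj =>
    Submodule.subset_span ⟨(i, ⟨j, by omega⟩), rfl⟩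
  let b' : Fin m → E := fun i => ⟨b i, by simpa using hE i 0 (Nat.zero_le _)⟩
  let S : E →ₗ[ℂ] E := (E.orthogonalProjectionOnto.comp (T.comp E.subtypeL)).toLinearMap
  have hS : ∀ y : E, S y = E.orthogonalProjectionOnto (T y) := fun _ => rfl
  have hinner : ∀ x y : E, inner ℂ x (S y) = inner ℂ (x : H) (T y) := fun x y => by
    rw [hS, Submodule.inner_orthogonalProjectionOnto_eq_of_mem_left]
  have hSsymm : S.IsSymmetric := fun x y => by
    rw [hinner, ← inner_conj_symm, hinner, inner_conj_symm, ← adjoint_inner_right,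
      isSelfAdjoint_iff'.1 hsa]
  set v := hSsymm.eigenvectorBasis rfl
  set lam := hSsymm.eigenvalues rfl
  have hv : ∀ k, S (v k) = (lam k : ℂ) • v k := hSsymm.apply_eigenvectorBasis rfl
  have hlam : ∀ k, inner ℂ (v k : H) (T (v k)) = (lam k : ℂ) := fun k => by
    rw [← hinner, hv, inner_smul_right, inner_self_eq_norm_sq_to_K, v.orthonormal.1 k]
    simp
  have hvn : ∀ k, ‖(v k : H)‖ = 1 := fun k => v.orthonormal.1 k
  have hlam0 : ∀ k, lam k ∈ Set.Icc 0 M := fun k => by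
    have h1 := congrArg Complex.re (hlam k)
    rw [Complex.ofReal_re] at h1
    constructor
    · rw [← h1, re_inner_apply_self_of_nonneg hT]
      positivity
    · have h2 : (inner ℂ (v k : H) (T (v k))).re ≤ ‖T‖ := by
        refine (Complex.re_le_norm _).trans ((norm_inner_le_norm _ _).trans ?_)
        have := T.le_opNorm (v k)
        rw [hvn, mul_one] at this
        rwa [hvn, one_mul]
      have : 0 ≤ ‖T‖ * ‖(1 : H →L[ℂ] H)‖ := by positivity
      linarith
  -- both operators have the same polynomial moments
  have hSpow : ∀ (j : ℕ) k, (S ^ j) (v k) = ((lam k : ℂ) ^ j) • v k := fun j k => by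
    induction j with
    | zero => simp
    | succ j ih => rw [pow_succ', Module.End.mul_apply, ih, map_smul, hv, smul_smul, pow_succ]
  have hmom : ∀ i, ∀ j ≤ q.natDegree, (inner ℂ (b i) ((T ^ j) (b i))).re =
      ∑ k, lam k ^ j * ‖(inner ℂ (v k) (b' i) : ℂ)‖ ^ 2 := fun i j hj => by
    rw [← compression_pow_apply T E (hE i) hS (b' i) rfl j hj]
    have h1 : (S ^ j) (b' i) = ∑ k, (inner ℂ (v k) (b' i) : ℂ) • (lam k : ℂ) ^ j • v k := by
      conv_lhs => rw [← v.sum_repr' (b' i)]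
      rw [map_sum]
      refine Finset.sum_congr rfl fun k _ => ?_
      rw [map_smul, hSpow]
    have h2 : inner ℂ (b i) (((S ^ j) (b' i) : E) : H) = inner ℂ (b' i) ((S ^ j) (b' i)) := rfl
    rw [h2, h1, inner_sum, Complex.re_sum]
    refine Finset.sum_congr rfl fun k _ => ?_
    rw [inner_smul_right, inner_smul_right, mul_left_comm, ← inner_conj_symm (b' i) (v k),
      Complex.mul_conj, Complex.normSq_eq_norm_sq, ← Complex.ofReal_pow, ← Complex.ofReal_mul,
      Complex.ofReal_re]
  have hq_mom : ∀ i, (inner ℂ (b i) (Polynomial.aeval T q (b i))).re =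
      ∑ k, q.eval (lam k) * ‖(inner ℂ (v k) (b' i) : ℂ)‖ ^ 2 := fun i => by
    rw [Polynomial.aeval_eq_sum_range, sum_apply, inner_sum, Complex.re_sum]
    simp_rw [Polynomial.eval_eq_sum_range, Finset.sum_mul]
    rw [Finset.sum_comm]
    refine Finset.sum_congr rfl fun j hj => ?_
    rw [smul_apply, inner_smul_right_eq_smul, Complex.smul_re,
      hmom i j (by simpa [Nat.lt_succ_iff] using hj), smul_eq_mul, Finset.mul_sum]
    exact Finset.sum_congr rfl fun k _ => by ring
  have hparseval : ∀ i, ∑ k, ‖(inner ℂ (v k) (b' i) : ℂ)‖ ^ 2 = 1 := fun i => by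
    rw [v.sum_sq_norm_inner_right]
    have : ‖b' i‖ = 1 := hb.1 i
    rw [this, one_pow]
  have hb' : Orthonormal ℂ b' := by
    rw [orthonormal_iff_ite] at hb ⊢
    exact hb
  refine ⟨_, fun k => (v k : H), ?_, ?_⟩
  · exact v.orthonormal.comp_linearIsometry E.subtypeₗᵢ
  -- One `ε` is lost in `T ^ p ≤ q(T) + ε`, the other in `q(λ) ≤ λ ^ p + ε`, where the weights sum
  -- to `1` by Parseval in `E`.
  have hterm : ∀ i, (inner ℂ (b i) ((T ^ p) (b i))).re ≤
      (∑ k, lam k ^ p * ‖(inner ℂ (v k) (b' i) : ℂ)‖ ^ 2) + 2 * ε := fun i => by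
    refine (re_inner_apply_mono hTp (b i)).trans ?_
    rw [map_add, Polynomial.aeval_C, Algebra.algebraMap_eq_smul_one,
      add_apply, inner_add_right, Complex.add_re, hq_mom,
      smul_apply, inner_smul_right_eq_smul, Complex.smul_re,
      one_apply_eq_self, inner_self_eq_norm_sq_to_K, hb.1 i]
    have h1 : ∑ k, q.eval (lam k) * ‖(inner ℂ (v k) (b' i) : ℂ)‖ ^ 2 ≤
        ∑ k, (lam k ^ p + ε) * ‖(inner ℂ (v k) (b' i) : ℂ)‖ ^ 2 := by
      refine Finset.sum_le_sum fun k _ => mul_le_mul_of_nonneg_right ?_ (sq_nonneg _)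
      have := (abs_lt.1 (hq _ (hlam0 k))).2
      linarith
    simp_rw [add_mul] at h1
    rw [Finset.sum_add_distrib, ← Finset.mul_sum, hparseval] at h1
    rw [RCLike.ofReal_one, one_pow, Complex.one_re, smul_eq_mul]
    linarith
  calc _ ≤ ∑ i, ((∑ k, lam k ^ p * ‖(inner ℂ (v k) (b' i) : ℂ)‖ ^ 2) + 2 * ε) :=
        Finset.sum_le_sum fun i _ => hterm i
    _ = (∑ k, lam k ^ p * ∑ i, ‖(inner ℂ (b' i) (v k) : ℂ)‖ ^ 2) + 2 * m * ε := by
        rw [Finset.sum_add_distrib, Finset.sum_comm]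
        simp_rw [Finset.mul_sum, norm_inner_symm (v _) (b' _)]
        simp
        ring
    _ ≤ _ := by
        gcongr with k
        rw [hlam, Complex.norm_real, Real.norm_of_nonneg (hlam0 k).1]
        -- Bessel for the orthonormal system `b'`: each eigenvalue carries total weight at most `1`.
        refine mul_le_of_le_one_right (Real.rpow_nonneg (hlam0 k).1 _) ?_
        refine (hb'.sum_inner_products_le _).trans_eq ?_
        rw [v.orthonormal.1 k, one_pow]

end Compression

/-! ### Minkowski's inequality for Pettis integrals. -/

section Integral

variable {H : Type*} [NormedAddCommGroup H] [InnerProductSpace ℂ H]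
variable {K : Type*} [NormedAddCommGroup K] [InnerProductSpace ℂ K]
variable {Ω : Type*} [MeasurableSpace Ω] {ρ : Measure Ω} {F : Ω → H →L[ℂ] K} {A : H →L[ℂ] K}

theorem lintegral_le_lowerIntegral {g h : Ω → ℝ≥0∞} (hg : Measurable g) (hgh : ∀ σ, g σ ≤ h σ) :
    ∫⁻ σ, g σ ∂ρ ≤ lowerIntegral ρ h :=
  le_iSup_of_le g (le_iSup_of_le hg (le_iSup_of_le (.of_forall hgh) le_rfl))

theorem ofReal_sum_rpow_rpow {n : ℕ} (x : Fin n → ℂ) {p : ℝ} (hp : 1 ≤ p) :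
    ENNReal.ofReal ((∑ k, ‖x k‖ ^ p) ^ (1 / p)) =
      (∑ k, ENNReal.ofReal (‖x k‖ ^ p)) ^ (1 / p) := by
  rw [← ENNReal.ofReal_rpow_of_nonneg (Finset.sum_nonneg fun _ _ => by positivity)
    (by positivity), ENNReal.ofReal_sum_of_nonneg fun _ _ => by positivity]

/-- The operator norm of a Pettis integral is at most the lower integral of the operator norms. -/
theorem IsPettisIntegral.enorm_le (hF : PointwisePettisIntegrable ρ F)
    (hA : IsPettisIntegral ρ F A) : ‖A‖ₑ ≤ lowerIntegral ρ fun σ => ‖F σ‖ₑ := by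
  rcases eq_or_ne (lowerIntegral ρ fun σ => ‖F σ‖ₑ) ∞ with htop | htop
  · rw [htop]
    exact le_top
  have h1 : ∀ (h : H) (k : K), ‖h‖ = 1 → ‖k‖ = 1 →
      ‖(inner ℂ k (A h) : ℂ)‖ₑ ≤ lowerIntegral ρ fun σ => ‖F σ‖ₑ := fun h k hh hk => by
    rw [hA h k]
    refine (enorm_integral_le_lintegral_enorm _).trans
      (lintegral_le_lowerIntegral (hF.measurable h k).enorm fun σ => ?_)
    rw [enorm_le_iff_norm_le]
    refine (norm_inner_le_norm _ _).trans ?_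
    rw [hk, one_mul]
    exact ((F σ).le_opNorm h).trans_eq (by rw [hh, mul_one])
  have h2 : ‖A‖ ≤ (lowerIntegral ρ fun σ => ‖F σ‖ₑ).toReal := by
    refine ContinuousLinearMap.opNorm_le_of_unit_norm ENNReal.toReal_nonneg fun h hh => ?_
    rcases eq_or_ne (A h) 0 with h0 | h0
    · rw [h0, norm_zero]
      exact ENNReal.toReal_nonneg
    have hn : ‖A h‖ ≠ 0 := norm_ne_zero_iff.2 h0
    have h3 := h1 h (((‖A h‖⁻¹ : ℝ) : ℂ) • A h) hh (by simp [norm_smul, hn])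
    have h4 : (inner ℂ (((‖A h‖⁻¹ : ℝ) : ℂ) • A h) (A h) : ℂ) = (‖A h‖ : ℂ) := by
      rw [inner_smul_left, inner_self_eq_norm_sq_to_K, Complex.conj_ofReal]
      simp [sq, hn]
    rw [h4] at h3
    have h5 := ENNReal.toReal_mono htop h3
    simpa using h5
  rw [← ofReal_norm]
  exact ENNReal.ofReal_le_of_le_toReal h2

variable [CompleteSpace H] [CompleteSpace K]

/-- Diagonals of `W A`, with a contraction `W`, in finite orthonormal systems have `ℓ^p` norm at
most the lower integral of the Schatten norms of the integrand. -/
theorem IsPettisIntegral.sum_norm_inner_rpow_le {ι : Type*} (b : HilbertBasis ι ℂ H)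
    (hF : PointwisePettisIntegrable ρ F) (hA : IsPettisIntegral ρ F A) {p : ℝ≥0∞} (hp : 1 ≤ p)
    (hp' : p ≠ ∞) {W : K →L[ℂ] H} (hW : ‖W‖ ≤ 1) {n : ℕ} {e : Fin n → H}
    (he : Orthonormal ℂ e) :
    ENNReal.ofReal ((∑ k, ‖(inner ℂ (e k) (W (A (e k))) : ℂ)‖ ^ p.toReal) ^ (1 / p.toReal)) ≤
      lowerIntegral ρ fun σ => schattenNorm b p (F σ) := by
  have : Fact (1 ≤ p) := ⟨hp⟩
  have hp1 : 1 ≤ p.toReal := by simpa using ENNReal.toReal_mono hp' hp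
  have hp0 : 0 < p.toReal := by linarith
  -- With the diagonal viewed in `ℓ^p_n`, Minkowski's inequality is `‖∫ v‖ ≤ ∫ ‖v‖`. Moving `W` onto
  -- `e k` makes each coordinate a matrix coefficient of `F`.
  let v : Ω → PiLp p fun _ : Fin n => ℂ :=
    fun σ => WithLp.toLp p fun k => inner ℂ (e k) (W (F σ (e k)))
  have hv : ∀ σ k, v σ k = inner ℂ (adjoint W (e k)) (F σ (e k)) := fun σ k =>
    (adjoint_inner_left W _ _).symm
  have hmeas : ∀ k, Measurable fun σ => v σ k := fun k => by
    simp_rw [hv]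
    exact hF.measurable _ _
  have hint : ∀ k, Integrable (fun σ => v σ k) ρ := fun k => by
    simp_rw [hv]
    exact hF.integrable _ _
  have hI : ∀ k, (∫ σ, v σ ∂ρ) k = inner ℂ (e k) (W (A (e k))) := fun k => by
    rw [eval_integral_piLp hint, ← adjoint_inner_left, hA]
    exact integral_congr_ae (.of_forall fun σ => hv σ k)
  have hnorm : ∀ x : PiLp p fun _ : Fin n => ℂ,
      ‖x‖ₑ = (∑ k, ENNReal.ofReal (‖x k‖ ^ p.toReal)) ^ (1 / p.toReal) := fun x => by
    rw [← ofReal_norm, PiLp.norm_eq_sum hp0, ofReal_sum_rpow_rpow _ hp1]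
  have h1 := enorm_integral_le_lintegral_enorm (μ := ρ) v
  rw [hnorm] at h1
  simp_rw [hI] at h1
  rw [ofReal_sum_rpow_rpow _ hp1]
  refine h1.trans (lintegral_le_lowerIntegral ?_ fun σ => ?_)
  · simp_rw [hnorm]
    exact (Finset.measurable_sum _ fun k _ =>
      ((hmeas k).norm.pow_const _).ennreal_ofReal).pow_const _
  · rw [hnorm, schattenNorm, if_neg hp']
    exact ENNReal.rpow_le_rpow (SchattenMinkowski.sum_norm_inner_rpow_le b (F σ) hW hp1 he)
      (by positivity)

/-- **Minkowski's integral inequality** for Schatten norms. -/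
theorem IsPettisIntegral.schattenNorm_le {ι : Type*} (b : HilbertBasis ι ℂ H)
    (hF : PointwisePettisIntegrable ρ F) (hA : IsPettisIntegral ρ F A) {p : ℝ≥0∞} (hp : 1 ≤ p) :
    schattenNorm b p A ≤ lowerIntegral ρ fun σ => schattenNorm b p (F σ) := by
  rcases eq_or_ne p ∞ with rfl | hp'
  · simpa only [schattenNorm, if_true] using hA.enorm_le hF
  have hp1 : 1 ≤ p.toReal := by simpa using ENNReal.toReal_mono hp' hp
  have hp0 : 0 < p.toReal := by linarith
  obtain ⟨V, hV, -, hVA⟩ := exists_polar A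
  have hT := absOp_nonneg A
  have hTp : 0 ≤ absOp A ^ p.toReal := CFC.rpow_nonneg
  set L := lowerIntegral ρ fun σ => schattenNorm b p (F σ)
  rw [schattenNorm, if_neg hp', one_div, ENNReal.rpow_inv_le_iff hp0, absPow_eq_absOp_rpow A hp0.le]
  rw [ENNReal.tsum_eq_iSup_sum]
  refine iSup_le fun J => ?_
  refine ENNReal.le_of_forall_pos_le_add fun ε hε _ => ?_
  rw [← ENNReal.ofReal_sum_of_nonneg fun i _ => by
    rw [re_inner_apply_self_of_nonneg hTp]; positivity]
  let f : Fin J.card → ι := fun i => (J.equivFin.symm i : ι)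
  have hf : Function.Injective f := Subtype.val_injective.comp J.equivFin.symm.injective
  -- Chosen so that the error `2 * J.card * δ` is at most `ε`; the `+ 1` covers empty `J`.
  have hδ : 0 < (ε : ℝ) / (2 * (J.card + 1)) := by positivity
  obtain ⟨n, e, he, h1⟩ := exists_orthonormal_sum_rpow_ge hT hp1 (b.orthonormal.comp f hf) hδ
  have h2 : ∑ i, (inner ℂ ((b ∘ f) i) ((absOp A ^ p.toReal) ((b ∘ f) i))).re =
      ∑ i ∈ J, (inner ℂ (b i) ((absOp A ^ p.toReal) (b i))).re := by
    rw [← Finset.sum_coe_sort J]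
    exact J.equivFin.symm.sum_comp fun i : J => (inner ℂ (b i) ((absOp A ^ p.toReal) (b i))).re
  have h3 : 2 * (J.card : ℝ) * ((ε : ℝ) / (2 * (J.card + 1))) ≤ ε := by
    rw [mul_div_assoc', div_le_iff₀ (by positivity)]
    nlinarith [ε.2, (Nat.cast_nonneg J.card : (0 : ℝ) ≤ J.card), NNReal.coe_pos.2 hε]
  -- Since `V*A = |A|`, the contraction `W = V*` yields exactly the diagonal of `|A|` from the
  -- approximation.
  have h4 := hA.sum_norm_inner_rpow_le b hF hp hp' (W := adjoint V)
    ((LinearIsometryEquiv.norm_map _ _).trans_le hV) he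
  have h5 : ∀ x, adjoint V (A x) = absOp A x := fun x => congrArg (· x) hVA
  simp_rw [h5] at h4
  have hnn : 0 ≤ ∑ k, ‖(inner ℂ (e k) (absOp A (e k)) : ℂ)‖ ^ p.toReal :=
    Finset.sum_nonneg fun _ _ => by positivity
  rw [← ENNReal.ofReal_rpow_of_nonneg hnn (by positivity), one_div,
    ENNReal.rpow_inv_le_iff hp0] at h4
  rw [← h2]
  refine (ENNReal.ofReal_le_ofReal (h1.trans (add_le_add_right h3 _))).trans ?_
  rw [ENNReal.ofReal_add hnn ε.coe_nonneg, ENNReal.ofReal_coe_nnreal]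
  exact add_le_add_left h4 _

end Integral

end SchattenMinkowski

theorem theorem3p10 {Ω : Type*} [MeasurableSpace Ω] (ρ : MeasureTheory.Measure Ω)
    {H : Type*} [NormedAddCommGroup H] [InnerProductSpace ℂ H] [CompleteSpace H]
    {K : Type*} [NormedAddCommGroup K] [InnerProductSpace ℂ K] [CompleteSpace K]
    {ι : Type*} (b : HilbertBasis ι ℂ H)
    (F : Ω → H →L[ℂ] K) (hF : SchattenMinkowski.PointwisePettisIntegrable ρ F)
    (p : ENNReal) (hp : 1 ≤ p) :
    SchattenMinkowski.schattenNorm b p (SchattenMinkowski.pettisIntegral hF) ≤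
        SchattenMinkowski.lowerIntegral ρ
          (fun σ => SchattenMinkowski.schattenNorm b p (F σ)) ∧
      (SchattenMinkowski.lowerIntegral ρ
          (fun σ => SchattenMinkowski.schattenNorm b p (F σ)) < ⊤ →
        SchattenMinkowski.pettisIntegral hF ∈ SchattenMinkowski.schattenClass b K p) := by

  have h := (SchattenMinkowski.isPettisIntegral_pettisIntegral hF).schattenNorm_le b hF hp
  exact ⟨h, h.trans_lt⟩
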